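/- Let $G$ be a compact (Hausdorff) abelian group with Haar probability measure $\mu_G$ and dual group $\widehat G$ (the continuous homomorphisms $\gamma:G\to S^1$). For $z=e^{2\pi i\theta}\in S^1$ with $\theta\in(-1/2,1/2]$ put $\|z\|=|\theta|$. For a finite set $\Gamma\subset\widehat G$ with $d=|\Gamma|$, and $\delta\in\mathbb R$, let $B(\Gamma,\delta)=\{x\in G:\|\gamma(x)\|\le\delta\text{ for all }\gamma\in\Gamma\}$. Given constants $c_{\mathcal R},C_{\mathcal R}>0$, and $\delta\in(0,1]$, call $B(\Gamma,\delta)$ regular if $$\left|\frac{\mu_G(B(\Gamma,(1+\kappa)\delta))}{\mu_G(B(\Gamma,\delta))}-1\right|\le C_{\mathcal R}|\kappa|d\quad\text{for all real }\kappa\text{ with }|\kappa|d\le c_{\mathcal R}.$$ Let $\beta$ be the restriction of $\mu_G$ to $B(\Gamma,\delta)$, normalized to be a probability measure, and for $f\in L^1(\beta)$ let $\widehat{f\,d\beta}(\gamma)=\int f\,\overline{\gamma}\,d\beta$. For all $c_{\mathcal R},C_{\mathcal R}>0$ there are constants $C,c>0$, depending only on $c_{\mathcal R},C_{\mathcal R}$,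 such that the following holds. Let $G$ be a compact abelian group, let $B(\Gamma,\delta)$ be a regular Bohr set with $\delta\in(0,1]$ and $d=|\Gamma|<\infty$, let $f\in L^2(\beta)$ be complex-valued and not $\beta$-almost everywhere zero, and let $\epsilon,\eta\in(0,1]$. Write $$L=1+\log\frac{\|f\|_{L^2(\beta)}^2}{\|f\|_{L^1(\beta)}^2}.$$ Then there are a finite set $\Lambda\subset\widehat G$ and a $\delta'\in(0,1]$ such that $$|\Lambda|\le C\epsilon^{-2}L,\qquad \delta'\ge c\,\frac{\delta\eta\epsilon^2}{\max(1,d)^2\,L},$$ and $$\{\gamma\in\widehat G:|\widehat{f\,d\beta}(\gamma)|\ge\epsilon\|f\|_{L^1(\beta)}\}\subset\{\gamma\in\widehat G:|1-\gamma(x)|\le\eta\text{ for all }x\in B(\Gamma\cup\Lambda,\delta')\}.$$ -/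

import Mathlib

open MeasureTheory

noncomputable section

namespace LocalChang

/-- The valuation `‖z‖ = |θ|` on the circle, where `z = exp (2 π i θ)` and `θ ∈ (-1/2, 1/2]`. -/
def circleVal (z : Circle) : ℝ :=
  |Complex.arg (z : ℂ)| / (2 * Real.pi)

section

variable {G : Type*} [CommGroup G] [TopologicalSpace G]

/-- The Bohr set `B(Γ, δ)` of a set `Γ` of continuous characters. -/
def bohrSet (Γ : Set (PontryaginDual G)) (δ : ℝ) : Set G :=
  {x | ∀ γ ∈ Γ, circleVal (γ x) ≤ δ}

variable [MeasurableSpace G]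

/-- `B(Γ, δ)` is regular, with the two absolute constants `cR` (the range of `κ`) and `CR`
(the constant implied by the `O`-notation): writing `d = |Γ|`,
`μ(B(Γ, (1 + κ) δ)) / μ(B(Γ, δ)) = 1 + O(|κ| d)` whenever `|κ| d ≤ cR`. -/
def IsRegularBohr (cR CR : ℝ) (μ : Measure G) (Γ : Finset (PontryaginDual G)) (δ : ℝ) : Prop :=
  ∀ κ : ℝ, |κ| * (Γ.card : ℝ) ≤ cR →
    |μ.real (bohrSet (Γ : Set (PontryaginDual G)) ((1 + κ) * δ)) /
        μ.real (bohrSet (Γ : Set (PontryaginDual G)) δ) - 1| ≤ CR * (|κ| * (Γ.card : ℝ))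

/-- The normalized Bohr cutoff `β`: the restriction of `μ` to `B(Γ, δ)`, scaled to have
total mass `1`. -/
def bohrMeasure (μ : Measure G) (Γ : Finset (PontryaginDual G)) (δ : ℝ) : Measure G :=
  ProbabilityTheory.cond μ (bohrSet (Γ : Set (PontryaginDual G)) δ)

/-- The Fourier transform `(f dν)^(γ) = ∫ f(x) conj(γ(x)) dν(x)` of the measure `f dν`. -/
def fourierCoeff (ν : Measure G) (f : G → ℂ) (γ : PontryaginDual G) : ℂ :=
  ∫ x, f x * (starRingEnd ℂ) ((γ x : Circle) : ℂ) ∂ν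

end

end LocalChang

end

/-! Let `ν` be the normalized measure on a Bohr set `B(Γ, r)` with `r ≤ t` much smaller than `δ`,
and let `S` be the set of characters with `|ν̂| ≥ 1/2`. Take `Λ` of maximal size among the subsets
of the large spectrum of `f` that are dissociated modulo `S`. By maximality every `γ` in the large
spectrum is a product of elements of `Λ` with exponents in `{-1, 0, 1}`, times an element of `S`
(`exists_isDissociated_span`). On `B(Γ ∪ Λ, δ')` the product is close to `1` factor by factor. The
element of `S` is close to `1` because `r` is pigeonholed so that `B(Γ, r)` is almost invariant
under `B(Γ, κ)` with `κ ≥ δ'` (`exists_almost_invariant_radius`,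
`norm_one_sub_le_of_almost_invariant`).

The size of `Λ` is bounded by Chang's argument, with Riesz products tested against `β`. The new
point is that a Riesz product over `K` dissociated characters has bounded mean on `B(Γ, δ)`
(`setIntegral_riesz_le`). Being nonnegative, its integral there is at most the integral over `B(Γ, δ
+ K t)` of its `K`-fold average under `ν`. The averaging shrinks each nonconstant coefficient by `2
^ (-K)`, while the coefficients have total mass at most `2 ^ K`. Regularity then compares the two
Bohr sets when `K t` is a small multiple of `δ / max 1 d`.

Bounded Riesz means give subgaussian exponential moments for sums of the characters. The entropy
inequality pairs these with `|f|`, whose entropy is at most `log (‖f‖₂² / ‖f‖₁²)`, and yields a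
bound of order `ε⁻² L` (`card_mul_sq_le_log`). -/

namespace LocalChang

/-! ### The valuation on the circle -/

lemma circleVal_nonneg (z : Circle) : 0 ≤ circleVal z := by
  unfold circleVal; positivity

lemma circleVal_exp_le (t : ℝ) : circleVal (Circle.exp t) ≤ |t| / (2 * Real.pi) := by
  unfold circleVal
  refine div_le_div_of_nonneg_right ?_ (by positivity)
  rcases le_or_gt |t| Real.pi with h | h
  -- At `t = -π` the argument jumps to `π`, outside the range where it equals `t`.
  · rcases eq_or_ne t (-Real.pi) with rfl | h'
    · rw [abs_neg, abs_of_pos Real.pi_pos]; exact Complex.abs_arg_le_pi _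
    · rw [abs_le] at h
      rw [Circle.arg_exp (lt_of_le_of_ne h.1 (Ne.symm h')) h.2]
  · exact (Complex.abs_arg_le_pi _).trans h.le

lemma circleVal_mul_le (z w : Circle) : circleVal (z * w) ≤ circleVal z + circleVal w := by
  conv_lhs => rw [← Circle.exp_arg z, ← Circle.exp_arg w, ← Circle.exp_add]
  refine (circleVal_exp_le _).trans ?_
  unfold circleVal
  rw [← add_div]
  gcongr
  exact abs_add_le _ _

lemma circleVal_div_le (z w : Circle) :
    circleVal (z / w) ≤ |(z : ℂ).arg - (w : ℂ).arg| / (2 * Real.pi) := by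
  conv_lhs => rw [← Circle.exp_arg z, ← Circle.exp_arg w, ← Circle.exp_sub]
  exact circleVal_exp_le _

lemma circleVal_inv (z : Circle) : circleVal z⁻¹ = circleVal z := by
  have key : ∀ w : Circle, circleVal w⁻¹ ≤ circleVal w := fun w => by
    conv_lhs => rw [← Circle.exp_arg w, ← Circle.exp_neg]
    refine (circleVal_exp_le _).trans ?_
    rw [abs_neg, circleVal]
  refine le_antisymm (key z) ?_
  simpa using key z⁻¹

lemma circleVal_one : circleVal 1 = 0 := by simp [circleVal]

lemma norm_one_sub_le_circleVal (z : Circle) :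
    ‖(1 : ℂ) - (z : ℂ)‖ ≤ 2 * Real.pi * circleVal z := by
  have h := Real.norm_exp_I_mul_ofReal_sub_one_le (x := (z : ℂ).arg)
  have hz : Complex.exp (Complex.I * ((z : ℂ).arg : ℂ)) = z := by
    conv_rhs => rw [← Circle.exp_arg z]
    rw [Circle.coe_exp, mul_comm]
  rw [hz, ← norm_neg, neg_sub] at h
  refine h.trans (le_of_eq ?_)
  unfold circleVal
  rw [Real.norm_eq_abs]
  field_simp

/-! ### Bohr sets: positivity, doubling and almost invariance -/

section Bohr

variable {G : Type*} [CommGroup G] [TopologicalSpace G]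

lemma bohrSet_mono (Γ : Set (PontryaginDual G)) {s t : ℝ} (h : s ≤ t) :
    bohrSet Γ s ⊆ bohrSet Γ t := fun _ hx γ hγ => (hx γ hγ).trans h

lemma mul_mem_bohrSet {Γ : Set (PontryaginDual G)} {s t : ℝ} {x y : G}
    (hx : x ∈ bohrSet Γ s) (hy : y ∈ bohrSet Γ t) : x * y ∈ bohrSet Γ (s + t) := by
  intro γ hγ
  rw [map_mul]
  exact (circleVal_mul_le _ _).trans (add_le_add (hx γ hγ) (hy γ hγ))

lemma inv_mem_bohrSet {Γ : Set (PontryaginDual G)} {s : ℝ} {x : G}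
    (hx : x ∈ bohrSet Γ s) : x⁻¹ ∈ bohrSet Γ s := by
  intro γ hγ
  rw [map_inv, circleVal_inv]
  exact hx γ hγ

lemma continuous_coe_character (γ : PontryaginDual G) :
    Continuous fun x => ((γ x : Circle) : ℂ) :=
  continuous_subtype_val.comp (map_continuous γ)

lemma norm_coe_character (γ : PontryaginDual G) (x : G) : ‖((γ x : Circle) : ℂ)‖ = 1 :=
  Circle.norm_coe _

variable [MeasurableSpace G]

variable (μ : Measure G) [μ.IsHaarMeasure]

/-- The argument is continuous at `1`, so the Bohr set is a neighbourhood of the identity, which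
Haar measure charges. -/
lemma measureReal_bohrSet_pos [IsProbabilityMeasure μ]
    (Γ : Finset (PontryaginDual G)) {s : ℝ} (hs : 0 < s) :
    0 < μ.real (bohrSet (Γ : Set (PontryaginDual G)) s) := by
  have hn : bohrSet (Γ : Set (PontryaginDual G)) s ∈ nhds (1 : G) := by
    have : bohrSet (Γ : Set (PontryaginDual G)) s = ⋂ γ ∈ Γ, {x | circleVal (γ x) ≤ s} := by
      ext x; simp [bohrSet]
    rw [this, Filter.biInter_finset_mem]
    intro γ _
    have hc : ContinuousAt (fun x : G => circleVal (γ x)) 1 := by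
      have h1 : ContinuousAt (fun x : G => ((γ x : Circle) : ℂ)) 1 :=
        (continuous_coe_character γ).continuousAt
      have h2 : ContinuousAt Complex.arg ((γ 1 : Circle) : ℂ) :=
        Complex.continuousAt_arg (by simp)
      have h3 : ContinuousAt (fun x : G => ((γ x : Circle) : ℂ).arg) 1 :=
        ContinuousAt.comp (f := fun x : G => ((γ x : Circle) : ℂ)) h2 h1
      exact h3.abs.div_const _
    have h0 : circleVal (γ 1) < s := by rw [map_one, circleVal_one]; exact hs
    exact (hc.eventually (gt_mem_nhds h0)).mono fun x hx => le_of_lt hx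
  have hpos := Measure.measure_pos_of_mem_nhds μ hn
  exact ENNReal.toReal_pos hpos.ne' (measure_ne_top _ _)

variable [BorelSpace G]

lemma measurable_coe_character (γ : PontryaginDual G) :
    Measurable fun x => ((γ x : Circle) : ℂ) :=
  (continuous_coe_character γ).measurable

lemma measurable_circleVal_character (γ : PontryaginDual G) :
    Measurable fun x => circleVal (γ x) :=
  ((Complex.measurable_arg.comp (measurable_coe_character γ)).norm).div_const _

lemma measurableSet_bohrSet (Γ : Finset (PontryaginDual G)) (s : ℝ) :
    MeasurableSet (bohrSet (Γ : Set (PontryaginDual G)) s) := by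
  have : bohrSet (Γ : Set (PontryaginDual G)) s = ⋂ γ ∈ Γ, {x | circleVal (γ x) ≤ s} := by
    ext x; simp [bohrSet]
  rw [this]
  exact Finset.measurableSet_biInter _ fun γ _ =>
    measurableSet_le (measurable_circleVal_character γ) measurable_const

variable [IsTopologicalGroup G]

lemma measureReal_le_bohrSet_of_div_mem [IsProbabilityMeasure μ] (Γ : Finset (PontryaginDual G))
    {s : ℝ} {A : Set G} (hA : ∀ x ∈ A, ∀ y ∈ A, x⁻¹ * y ∈ bohrSet (Γ : Set (PontryaginDual G)) s) :
    μ.real A ≤ μ.real (bohrSet (Γ : Set (PontryaginDual G)) s) := by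
  rcases A.eq_empty_or_nonempty with rfl | ⟨x, hx⟩
  · simp
  · have h : A ⊆ (fun y => x⁻¹ * y) ⁻¹' bohrSet (Γ : Set (PontryaginDual G)) s :=
      fun y hy => hA x hx y hy
    refine (measureReal_mono h).trans (le_of_eq ?_)
    rw [Measure.real, measure_preimage_mul, Measure.real]

/-- Cut the argument of each `γ x` into windows of length `π s`. On `B(Γ, s)` the argument lies in
`[-2πs, 2πs]`, which meets five windows, the last only at its endpoint. Quotients of points in a
common cell lie in `B(Γ, s / 2)`. -/
lemma measureReal_bohrSet_le_doubling [IsProbabilityMeasure μ] (Γ : Finset (PontryaginDual G))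
    {s : ℝ} (hs : 0 < s) :
    μ.real (bohrSet (Γ : Set (PontryaginDual G)) s) ≤
      5 ^ Γ.card * μ.real (bohrSet (Γ : Set (PontryaginDual G)) (s / 2)) := by
  classical
  set B : Set G := bohrSet (Γ : Set (PontryaginDual G)) s with hB
  let θ : PontryaginDual G → G → ℤ := fun γ x => ⌊((γ x : Circle) : ℂ).arg / (Real.pi * s)⌋
  let T : Finset (Γ → ℤ) := Fintype.piFinset fun _ => Finset.Icc (-2) 2
  let cell : (Γ → ℤ) → Set G := fun m => {x | x ∈ B ∧ ∀ γ : Γ, θ γ x = m γ}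
  have hps : 0 < Real.pi * s := by positivity
  have hcover : B ⊆ ⋃ m ∈ T, cell m := by
    intro x hx
    simp only [Set.mem_iUnion]
    refine ⟨fun γ => θ γ x, ?_, hx, fun _ => rfl⟩
    simp only [T, Fintype.mem_piFinset, Finset.mem_Icc, θ]
    intro γ
    have h := hx γ γ.2
    unfold circleVal at h
    rw [div_le_iff₀ (by positivity), abs_le] at h
    constructor
    · rw [Int.le_floor, le_div_iff₀ hps]; push_cast; nlinarith
    · rw [← Int.lt_add_one_iff, Int.floor_lt, div_lt_iff₀ hps]; push_cast; nlinarith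
  have hcell : ∀ m, μ.real (cell m) ≤ μ.real (bohrSet (Γ : Set (PontryaginDual G)) (s / 2)) := by
    intro m
    refine measureReal_le_bohrSet_of_div_mem μ Γ fun x hx y hy γ hγ => ?_
    rw [mul_comm, ← div_eq_mul_inv, map_div]
    refine (circleVal_div_le _ _).trans ?_
    rw [div_le_iff₀ (by positivity)]
    have h := Int.abs_sub_lt_one_of_floor_eq_floor ((hy.2 ⟨γ, hγ⟩).trans (hx.2 ⟨γ, hγ⟩).symm)
    simp only at h
    rw [← sub_div, abs_div, abs_of_pos hps, div_lt_one hps] at h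
    linarith
  calc μ.real B ≤ μ.real (⋃ m ∈ T, cell m) := measureReal_mono hcover (measure_ne_top _ _)
    _ ≤ ∑ m ∈ T, μ.real (cell m) := measureReal_biUnion_finset_le _ _
    _ ≤ ∑ _m ∈ T, μ.real (bohrSet (Γ : Set (PontryaginDual G)) (s / 2)) :=
        Finset.sum_le_sum fun m _ => hcell m
    _ = _ := by simp [T]

/-- Otherwise every step gains more than a factor `1 + η`. By Bernoulli `n` steps gain at least `2`,
so `n * k` steps would exceed `2 ^ k`. -/
lemma exists_step_le_of_le {a : ℕ → ℝ} {N n k : ℕ} {η : ℝ} (hη : 0 < η) (hn : 1 ≤ η * n)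
    (hk : 0 < k) (hn0 : 0 < n) (hN : N = n * k) (ha : 0 < a 0) (hb : a N ≤ 2 ^ k * a 0) :
    ∃ j < N, a (j + 1) ≤ (1 + η) * a j := by
  by_contra! h
  have hlt : ∀ j, j ≤ N → (1 + η) ^ j * a 0 ≤ a j ∧ (0 < j → (1 + η) ^ j * a 0 < a j) := by
    intro j
    induction j with
    | zero => simp
    | succ j ih =>
      intro hj
      have h1 := (ih (by omega)).1
      have h2 := h j (by omega)
      have : (1 + η) ^ (j + 1) * a 0 < a (j + 1) := by
        calc (1 + η) ^ (j + 1) * a 0 = (1 + η) * ((1 + η) ^ j * a 0) := by ring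
          _ ≤ (1 + η) * a j := by gcongr
          _ < _ := h2
      exact ⟨this.le, fun _ => this⟩
  have h1 := (hlt N le_rfl).2 (hN ▸ Nat.mul_pos hn0 hk)
  have h2 : (2 : ℝ) ≤ (1 + η) ^ n := by
    have := one_add_mul_le_pow (a := η) (by linarith) n
    nlinarith
  have h3 : (2 : ℝ) ^ k ≤ (1 + η) ^ N := by
    rw [hN, pow_mul]; gcongr
  nlinarith

/-- Every scale below `s` contains a radius at which a Bohr set is almost invariant under a
comparatively large Bohr set. -/
lemma exists_almost_invariant_radius [IsProbabilityMeasure μ] (Γ : Finset (PontryaginDual G))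
    {s η : ℝ} (hs : 0 < s) (hη : 0 < η) (hη1 : η ≤ 1) :
    ∃ r κ : ℝ, κ < r ∧ r ≤ s ∧ 0 < κ ∧ s * η / (108 * max 1 (Γ.card : ℝ)) ≤ κ ∧
      μ.real (bohrSet (Γ : Set (PontryaginDual G)) (r + κ)) ≤
        (1 + η / 8) * μ.real (bohrSet (Γ : Set (PontryaginDual G)) (r - κ)) := by
  set n : ℕ := ⌈8 / η⌉₊ with hn
  set d : ℕ := max 1 Γ.card with hd
  have hd1 : 1 ≤ d := le_max_left _ _
  have hdc : ((d : ℕ) : ℝ) = max 1 (Γ.card : ℝ) := by simp [hd]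
  have hn8 : 8 / η ≤ n := Nat.le_ceil _
  have hn9 : (n : ℝ) ≤ 9 / η := by
    have h1 := (Nat.ceil_lt_add_one (show 0 ≤ 8 / η by positivity)).le
    have h2 : 1 ≤ 1 / η := by rw [le_div_iff₀ hη]; linarith
    calc (n : ℝ) ≤ 8 / η + 1 := h1
      _ ≤ 8 / η + 1 / η := by gcongr
      _ = 9 / η := by ring
  have hn0 : 0 < n := by
    have : (0 : ℝ) < n := lt_of_lt_of_le (by positivity) hn8
    exact_mod_cast this
  -- The interval `[s / 2, s]` is cut into `N` equal steps. The total growth is at most `5 ^ |Γ| ≤ 2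
  -- ^ (3 d)`, and `n` steps of ratio `1 + η / 8` already double, so some step has at most this
  -- ratio. Using `d = max 1 |Γ|` keeps `N` positive when `Γ` is empty.
  set N : ℕ := n * (3 * d) with hN
  have hN0 : 0 < N := by positivity
  have hNr : (0 : ℝ) < N := by exact_mod_cast hN0
  have hNle : (N : ℝ) ≤ 27 * d / η := by
    rw [hN]; push_cast
    calc (n : ℝ) * (3 * d) ≤ 9 / η * (3 * d) := by gcongr
      _ = _ := by ring
  let a : ℕ → ℝ := fun j => μ.real (bohrSet (Γ : Set (PontryaginDual G)) (s / 2 + j * (s / (2 * N))))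
  have ha0 : 0 < a 0 := measureReal_bohrSet_pos μ Γ (by simp; positivity)
  have haN : a N ≤ 2 ^ (3 * d) * a 0 := by
    have e1 : a N = μ.real (bohrSet (Γ : Set (PontryaginDual G)) s) := by
      simp only [a]; congr 2; field_simp; ring
    have e0 : a 0 = μ.real (bohrSet (Γ : Set (PontryaginDual G)) (s / 2)) := by simp [a]
    have h5 : (5 : ℝ) ^ Γ.card ≤ 2 ^ (3 * d) := by
      rw [pow_mul]
      calc (5 : ℝ) ^ Γ.card ≤ (2 ^ 3) ^ Γ.card := by gcongr; norm_num
        _ ≤ _ := by gcongr; · norm_num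
                    · exact le_max_right _ _
    calc a N ≤ 5 ^ Γ.card * a 0 := by rw [e1, e0]; exact measureReal_bohrSet_le_doubling μ Γ hs
      _ ≤ _ := by gcongr
  obtain ⟨j, hj, hstep⟩ := exists_step_le_of_le (η := η / 8) (by positivity)
    (by rw [div_le_iff₀ hη] at hn8; linarith) (by positivity) hn0 hN ha0 haN
  have hjr : (j : ℝ) + 1 ≤ N := by exact_mod_cast hj
  -- The midpoint and half-length of the good step; `N ≤ 27 d / η` turns `s / (4 N)` into the
  -- constant `108`.
  refine ⟨s / 2 + (j + 1 / 2) * (s / (2 * N)), s / (4 * N), ?_, ?_, by positivity, ?_, ?_⟩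
  · have h1 : s / (4 * N) = 1 / 2 * (s / (2 * N)) := by field_simp; norm_num
    have h2 : 0 < s / (2 * N) := by positivity
    have h3 : (0 : ℝ) ≤ j := by positivity
    rw [h1]; nlinarith
  · have h1 : (j + 1 / 2 : ℝ) * (s / (2 * N)) ≤ N * (s / (2 * N)) := by gcongr; linarith
    have h2 : (N : ℝ) * (s / (2 * N)) = s / 2 := by field_simp
    linarith
  · rw [← hdc, div_le_div_iff₀ (by positivity) (by positivity)]
    rw [le_div_iff₀ hη] at hNle
    nlinarith
  · have e1 : s / 2 + (j + 1 / 2 : ℝ) * (s / (2 * N)) + s / (4 * N)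
        = s / 2 + ((j + 1 : ℕ) : ℝ) * (s / (2 * N)) := by push_cast; field_simp; ring
    have e2 : s / 2 + (j + 1 / 2 : ℝ) * (s / (2 * N)) - s / (4 * N)
        = s / 2 + (j : ℝ) * (s / (2 * N)) := by field_simp; ring
    rw [e1, e2]; exact hstep

/-- A character with a large Fourier coefficient on an almost invariant Bohr set is nearly
constant on the set of almost periods. -/
lemma norm_one_sub_le_of_almost_invariant [IsProbabilityMeasure μ]
    (Γ : Finset (PontryaginDual G)) {r κ η : ℝ} (hκ : 0 < κ) (hκr : κ < r) (hη : 0 < η)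
    (hinv : μ.real (bohrSet (Γ : Set (PontryaginDual G)) (r + κ)) ≤
        (1 + η / 8) * μ.real (bohrSet (Γ : Set (PontryaginDual G)) (r - κ)))
    (χ : PontryaginDual G)
    (hχ : 1 / 2 ≤ ‖∫ y, ((χ y : Circle) : ℂ) ∂(bohrMeasure μ Γ r)‖)
    {x : G} (hx : x ∈ bohrSet (Γ : Set (PontryaginDual G)) κ) :
    ‖(1 : ℂ) - ((χ x : Circle) : ℂ)‖ ≤ η / 2 := by
  set B : ℝ → Set G := bohrSet (Γ : Set (PontryaginDual G)) with hB
  have hBm : ∀ t, MeasurableSet (B t) := measurableSet_bohrSet Γ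
  set g : G → ℂ := fun y => ((χ y : Circle) : ℂ) with hg
  have hgm : Measurable g := measurable_coe_character χ
  have hgn : ∀ y, ‖g y‖ = 1 := norm_coe_character χ
  have hgi : Integrable g μ := Integrable.of_bound hgm.aestronglyMeasurable 1
    (Filter.Eventually.of_forall fun y => (hgn y).le)
  have hpos : 0 < μ.real (B r) := measureReal_bohrSet_pos μ Γ (hκ.trans hκr)
  have hint : ∫ y, g y ∂(bohrMeasure μ Γ r) = ((μ.real (B r))⁻¹ : ℝ) • ∫ y in B r, g y ∂μ := by
    rw [bohrMeasure, ProbabilityTheory.cond, integral_smul_measure]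
    congr 1
    rw [ENNReal.toReal_inv, Measure.real]
  set S : Set G := (fun y => x⁻¹ * y) ⁻¹' B r with hS
  have hSm : MeasurableSet S := (hBm r).preimage (measurable_const_mul _)
  -- Translating by `x` multiplies the integral over `B r` by `χ x`. Hence `|1 - χ x|` times that
  -- integral is controlled by the annulus between `B (r - κ)` and `B (r + κ)`, outside which `B r`
  -- and its translate agree.
  have htrans : g x * ∫ y in B r, g y ∂μ = ∫ y in S, g y ∂μ := by
    rw [← integral_indicator (hBm r), ← integral_indicator hSm, ← integral_const_mul,
      ← integral_mul_left_eq_self (μ := μ) (fun y => S.indicator g y) x]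
    refine integral_congr_ae (Filter.Eventually.of_forall fun y => ?_)
    have : x * y ∈ S ↔ y ∈ B r := by simp [hS]
    by_cases hy : y ∈ B r
    · simp only [Set.indicator_of_mem hy, Set.indicator_of_mem (this.2 hy)]
      simp [hg]
    · simp only [Set.indicator_of_notMem hy, Set.indicator_of_notMem (mt this.1 hy), mul_zero]
  have hsub1 : B (r - κ) ⊆ B r := bohrSet_mono _ (by linarith)
  have hsub2 : B r ⊆ B (r + κ) := bohrSet_mono _ (by linarith)
  have hsub3 : B (r - κ) ⊆ S := fun y hy => by
    have := mul_mem_bohrSet (inv_mem_bohrSet hx) hy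
    rwa [add_sub_cancel] at this
  have hsub4 : S ⊆ B (r + κ) := fun y hy => by
    have := mul_mem_bohrSet hx (show x⁻¹ * y ∈ B r from hy)
    rw [mul_inv_cancel_left, add_comm] at this
    exact this
  have hdiff : ‖(∫ y in B r, g y ∂μ) - ∫ y in S, g y ∂μ‖ ≤
      1 * μ.real (B (r + κ) \ B (r - κ)) := by
    rw [← integral_indicator (hBm r), ← integral_indicator hSm,
      ← integral_sub (hgi.indicator (hBm r)) (hgi.indicator hSm)]
    have : ∫ y, ((B r).indicator g y - S.indicator g y) ∂μ =
        ∫ y in B (r + κ) \ B (r - κ), ((B r).indicator g y - S.indicator g y) ∂μ := by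
      rw [setIntegral_eq_integral_of_forall_compl_eq_zero]
      intro y hy
      by_cases h1 : y ∈ B (r - κ)
      · simp [Set.indicator_of_mem (hsub1 h1), Set.indicator_of_mem (hsub3 h1)]
      · have h2 : y ∉ B (r + κ) := fun h => hy ⟨h, h1⟩
        simp [Set.indicator_of_notMem (mt (@hsub2 y) h2), Set.indicator_of_notMem (mt (@hsub4 y) h2)]
    rw [this]
    refine norm_setIntegral_le_of_norm_le_const (measure_lt_top _ _) fun y _ => ?_
    by_cases h1 : y ∈ B r <;> by_cases h2 : y ∈ S <;> simp [h1, h2, hgn]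
  have hsd : μ.real (B (r + κ) \ B (r - κ)) ≤ η / 8 * μ.real (B r) := by
    rw [measureReal_sdiff (hsub1.trans hsub2) (hBm _)]
    have h1 : μ.real (B (r - κ)) ≤ μ.real (B r) := measureReal_mono hsub1
    nlinarith
  set I := ∫ y in B r, g y ∂μ with hI
  have hIlow : μ.real (B r) / 2 ≤ ‖I‖ := by
    rw [hint, norm_smul, Real.norm_eq_abs, abs_of_pos (inv_pos.2 hpos), inv_mul_eq_div,
      le_div_iff₀ hpos] at hχ
    linarith
  have hfin : ‖(1 : ℂ) - g x‖ * ‖I‖ ≤ η / 8 * μ.real (B r) := by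
    rw [← norm_mul, sub_mul, one_mul, htrans]
    linarith
  have h0 : 0 ≤ ‖(1 : ℂ) - g x‖ := norm_nonneg _
  have : ‖(1 : ℂ) - g x‖ * (μ.real (B r) / 2) ≤ η / 8 * μ.real (B r) :=
    (mul_le_mul_of_nonneg_left hIlow h0).trans hfin
  have h2 : ‖(1 : ℂ) - g x‖ / 2 ≤ η / 8 := by
    refine le_of_mul_le_mul_right ?_ hpos
    linarith
  change ‖(1 : ℂ) - g x‖ ≤ η / 2
  linarith

end Bohr

/-! ### Trigonometric polynomials and their averages -/

section TrigPoly

variable {G : Type*} [CommGroup G] [TopologicalSpace G] {ι : Type*} [Fintype ι]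

/-- The trigonometric polynomial with coefficients `c` and frequencies `χ`. -/
noncomputable def trigPoly (c : ι → ℂ) (χ : ι → PontryaginDual G) (x : G) : ℂ :=
  ∑ i, c i * ((χ i x : Circle) : ℂ)

lemma norm_trigPoly_le (c : ι → ℂ) (χ : ι → PontryaginDual G) (x : G) :
    ‖trigPoly c χ x‖ ≤ ∑ i, ‖c i‖ := by
  refine (norm_sum_le _ _).trans (Finset.sum_le_sum fun i _ => ?_)
  rw [norm_mul, norm_coe_character, mul_one]

lemma trigPoly_mul (c : ι → ℂ) (χ : ι → PontryaginDual G) (x y : G) :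
    trigPoly c χ (x * y) = trigPoly (fun i => c i * ((χ i y : Circle) : ℂ)) χ x := by
  unfold trigPoly
  refine Finset.sum_congr rfl fun i _ => ?_
  rw [map_mul, Circle.coe_mul]
  ring

variable [MeasurableSpace G] [BorelSpace G]

lemma integrable_character (ν : Measure G) [IsFiniteMeasure ν] (γ : PontryaginDual G) :
    Integrable (fun x => ((γ x : Circle) : ℂ)) ν :=
  Integrable.of_bound (measurable_coe_character γ).aestronglyMeasurable 1
    (Filter.Eventually.of_forall fun x => (norm_coe_character γ x).le)

lemma integrable_trigPoly (ν : Measure G) [IsFiniteMeasure ν] (c : ι → ℂ)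
    (χ : ι → PontryaginDual G) : Integrable (trigPoly c χ) ν :=
  integrable_finsetSum _ fun i _ => (integrable_character ν (χ i)).const_mul _

lemma integral_trigPoly (ν : Measure G) [IsFiniteMeasure ν] (c : ι → ℂ)
    (χ : ι → PontryaginDual G) :
    ∫ x, trigPoly c χ x ∂ν = ∑ i, c i * ∫ x, ((χ i x : Circle) : ℂ) ∂ν := by
  unfold trigPoly
  rw [integral_finsetSum _ fun i _ => (integrable_character ν (χ i)).const_mul _]
  simp_rw [integral_const_mul]

/-- The coefficients of the average of a trigonometric polynomial over translations by `ν`. -/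
noncomputable def smoothCoeff (ν : Measure G) (c : ι → ℂ) (χ : ι → PontryaginDual G) (i : ι) : ℂ :=
  c i * ∫ y, ((χ i y : Circle) : ℂ) ∂ν

lemma trigPoly_smoothCoeff (ν : Measure G) [IsFiniteMeasure ν] (c : ι → ℂ)
    (χ : ι → PontryaginDual G) (x : G) :
    trigPoly (smoothCoeff ν c χ) χ x = ∫ y, trigPoly c χ (x * y) ∂ν := by
  simp_rw [mul_comm x, trigPoly_mul, integral_trigPoly]
  unfold trigPoly smoothCoeff
  exact Finset.sum_congr rfl fun i _ => by ring

/-- Both sides are the same finite sum over frequencies, so the exchange of integrals requires no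
measurability on `G × G`. -/
lemma integral_trigPoly_smoothCoeff (ν ρ : Measure G) [IsFiniteMeasure ν] [IsFiniteMeasure ρ]
    (c : ι → ℂ) (χ : ι → PontryaginDual G) :
    ∫ x, trigPoly (smoothCoeff ν c χ) χ x ∂ρ = ∫ y, ∫ x, trigPoly c χ (x * y) ∂ρ ∂ν := by
  simp_rw [trigPoly_mul, integral_trigPoly]
  have : ∀ y : G, ∑ i, c i * ((χ i y : Circle) : ℂ) * ∫ x, ((χ i x : Circle) : ℂ) ∂ρ =
      trigPoly (fun i => c i * ∫ x, ((χ i x : Circle) : ℂ) ∂ρ) χ y := fun y =>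
    Finset.sum_congr rfl fun i _ => by ring
  simp_rw [this, integral_trigPoly]
  exact Finset.sum_congr rfl fun i _ => by unfold smoothCoeff; ring

lemma integral_re_eq {α : Type*} [MeasurableSpace α] {ν : Measure α} {f : α → ℂ}
    (hf : Integrable f ν) : ∫ x, (f x).re ∂ν = (∫ x, f x ∂ν).re :=
  integral_re hf

lemma integrable_trigPoly_mul_left (ν : Measure G) [IsFiniteMeasure ν] (c : ι → ℂ)
    (χ : ι → PontryaginDual G) (x : G) : Integrable (fun y => trigPoly c χ (x * y)) ν := by
  simp_rw [mul_comm x, trigPoly_mul]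
  exact integrable_trigPoly ν _ χ

lemma integrable_trigPoly_mul_right (ν : Measure G) [IsFiniteMeasure ν] (c : ι → ℂ)
    (χ : ι → PontryaginDual G) (y : G) : Integrable (fun x => trigPoly c χ (x * y)) ν := by
  simp_rw [trigPoly_mul]
  exact integrable_trigPoly ν _ χ

lemma re_trigPoly_smoothCoeff_nonneg (ν : Measure G) [IsFiniteMeasure ν] (c : ι → ℂ)
    (χ : ι → PontryaginDual G) (hF : ∀ x, 0 ≤ (trigPoly c χ x).re) (x : G) :
    0 ≤ (trigPoly (smoothCoeff ν c χ) χ x).re := by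
  rw [trigPoly_smoothCoeff, ← integral_re_eq (integrable_trigPoly_mul_left ν c χ x)]
  exact integral_nonneg fun y => hF _

variable [IsTopologicalGroup G] (μ : Measure G) [μ.IsHaarMeasure] [IsProbabilityMeasure μ]

/-- For `y` in `B(Γ, t)`, substituting `x * y` for `x` moves the domain into `B(Γ, s + t)`, and
nonnegativity allows enlarging it to the whole of that set. Averaging over `y` gives the claim. -/
lemma setIntegral_re_trigPoly_le_smoothCoeff (Γ : Finset (PontryaginDual G)) (s t : ℝ)
    (ν : Measure G) [IsProbabilityMeasure ν]
    (hν : ∀ᵐ y ∂ν, y ∈ bohrSet (Γ : Set (PontryaginDual G)) t) (c : ι → ℂ)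
    (χ : ι → PontryaginDual G) (hF : ∀ x, 0 ≤ (trigPoly c χ x).re) :
    ∫ x in bohrSet (Γ : Set (PontryaginDual G)) s, (trigPoly c χ x).re ∂μ ≤
      ∫ x in bohrSet (Γ : Set (PontryaginDual G)) (s + t),
        (trigPoly (smoothCoeff ν c χ) χ x).re ∂μ := by
  set B : ℝ → Set G := bohrSet (Γ : Set (PontryaginDual G)) with hB
  have hBm : ∀ t, MeasurableSet (B t) := measurableSet_bohrSet Γ
  rw [integral_re_eq (integrable_trigPoly (μ.restrict (B (s + t))) (smoothCoeff ν c χ) χ),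
    integral_trigPoly_smoothCoeff]
  have hint : Integrable (fun y => ∫ x in B (s + t), trigPoly c χ (x * y) ∂μ) ν := by
    simp_rw [trigPoly_mul, integral_trigPoly]
    refine integrable_finsetSum _ fun i _ => ?_
    exact ((integrable_character ν (χ i)).const_mul _).mul_const _
  rw [← integral_re_eq hint]
  have hconst : ∫ x in B s, (trigPoly c χ x).re ∂μ =
      ∫ _y, (∫ x in B s, (trigPoly c χ x).re ∂μ) ∂ν := by simp
  rw [hconst]
  refine integral_mono_ae (integrable_const _) hint.re ?_
  filter_upwards [hν] with y hy
  change _ ≤ (∫ x in B (s + t), trigPoly c χ (x * y) ∂μ).re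
  rw [← integral_re_eq (integrable_trigPoly_mul_right _ c χ y), ← integral_indicator (hBm s),
    ← integral_indicator (hBm (s + t)),
    ← integral_mul_right_eq_self (μ := μ) ((B s).indicator fun x => (trigPoly c χ x).re) y]
  refine integral_mono ?_ ?_ fun x => ?_
  · have := ((integrable_trigPoly μ c χ).re.indicator (hBm s)).comp_mul_right y
    exact this
  · exact (integrable_trigPoly_mul_right μ c χ y).re.indicator (hBm _)
  · by_cases h : x * y ∈ B s
    · have hx : x ∈ B (s + t) := by
        have := mul_mem_bohrSet h (inv_mem_bohrSet hy)
        rwa [mul_inv_cancel_right] at this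
      simp [Set.indicator_of_mem h, Set.indicator_of_mem hx]
    · simp only [Set.indicator_of_notMem h]
      exact Set.indicator_nonneg (fun _ _ => hF _) _

/-- Averaging preserves nonnegativity, so it can be repeated. Each round costs `t` in the radius and
one more factor of the transform of `ν` in each coefficient; the trivial bound on the polynomial
ends the recursion. -/
lemma setIntegral_re_trigPoly_le_iterate (Γ : Finset (PontryaginDual G)) (t : ℝ)
    (ν : Measure G) [IsProbabilityMeasure ν]
    (hν : ∀ᵐ y ∂ν, y ∈ bohrSet (Γ : Set (PontryaginDual G)) t)
    (χ : ι → PontryaginDual G) (k : ℕ) (s : ℝ) (c : ι → ℂ)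
    (hF : ∀ x, 0 ≤ (trigPoly c χ x).re) :
    ∫ x in bohrSet (Γ : Set (PontryaginDual G)) s, (trigPoly c χ x).re ∂μ ≤
      (∑ i, ‖c i‖ * ‖∫ y, ((χ i y : Circle) : ℂ) ∂ν‖ ^ k) *
        μ.real (bohrSet (Γ : Set (PontryaginDual G)) (s + k * t)) := by
  induction k generalizing s c with
  | zero =>
    have := norm_setIntegral_le_of_norm_le_const (μ := μ)
      (s := bohrSet (Γ : Set (PontryaginDual G)) s) (f := fun x => (trigPoly c χ x).re)
      (C := ∑ i, ‖c i‖) (measure_lt_top _ _)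
      (fun x _ => (Complex.abs_re_le_norm _).trans (norm_trigPoly_le c χ x))
    simpa using (le_abs_self _).trans this
  | succ k ih =>
    refine (setIntegral_re_trigPoly_le_smoothCoeff μ Γ s t ν hν c χ hF).trans ?_
    refine (ih (s + t) _ (re_trigPoly_smoothCoeff_nonneg ν c χ hF)).trans (le_of_eq ?_)
    have : s + t + k * t = s + ((k + 1 : ℕ) : ℝ) * t := by push_cast; ring
    rw [this]
    congr 1
    refine Finset.sum_congr rfl fun i _ => ?_
    rw [smoothCoeff, norm_mul, pow_succ]
    ring

end TrigPoly

/-! ### Riesz products -/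

section Riesz

variable {G : Type*} [CommGroup G] [TopologicalSpace G] {ι : Type*}

/-- The coefficients of a Riesz product in one variable. -/
noncomputable def rieszCoeff (a : ℂ) (m : SignType) : ℂ :=
  if m = 0 then 1 else if m = 1 then a / 2 else (starRingEnd ℂ) a / 2

lemma sum_rieszCoeff (a : ℂ) (z : Circle) :
    ∑ m : SignType, rieszCoeff a m * ((z ^ (m : ℤ) : Circle) : ℂ) = ((1 + (a * z).re : ℝ) : ℂ) := by
  have h : (((a * z).re : ℝ) : ℂ) = (a * z + (starRingEnd ℂ) (a * z)) / 2 := by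
    rw [Complex.add_conj]; push_cast; ring
  rw [SignType.univ_eq, Finset.sum_insert (by decide), Finset.sum_insert (by decide),
    Finset.sum_singleton]
  push_cast [h]
  simp [rieszCoeff, ← Circle.coe_inv_eq_conj]
  ring

lemma sum_norm_rieszCoeff_le {a : ℂ} (ha : ‖a‖ ≤ 1) :
    ∑ m : SignType, ‖rieszCoeff a m‖ ≤ 2 := by
  rw [SignType.univ_eq, Finset.sum_insert (by decide), Finset.sum_insert (by decide),
    Finset.sum_singleton]
  simp [rieszCoeff]
  linarith

lemma mul_character_apply (γ χ : PontryaginDual G) (x : G) : (γ * χ) x = γ x * χ x := rfl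

/-- Evaluation of characters at `x`, as a homomorphism. -/
noncomputable def characterEval (x : G) : PontryaginDual G →* Circle where
  toFun γ := γ x
  map_one' := rfl
  map_mul' _ _ := rfl

lemma prod_zpow_character_apply (Λ : Finset ι) (l : ι → PontryaginDual G) (m : ι → ℤ) (x : G) :
    (∏ i ∈ Λ, l i ^ m i : PontryaginDual G) x = ∏ i ∈ Λ, l i x ^ m i := by
  change characterEval x _ = ∏ i ∈ Λ, characterEval x (l i) ^ m i
  simp_rw [map_prod, map_zpow]

variable [Fintype ι]

lemma prod_one_add_re_eq_trigPoly [DecidableEq ι] (a : ι → ℂ) (l : ι → PontryaginDual G) (x : G) :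
    ((∏ i, (1 + (a i * ((l i x : Circle) : ℂ)).re) : ℝ) : ℂ) =
      trigPoly (fun m : ι → SignType => ∏ i, rieszCoeff (a i) (m i))
        (fun m => ∏ i, l i ^ (m i : ℤ)) x := by
  rw [Complex.ofReal_prod]
  simp_rw [← sum_rieszCoeff]
  rw [Finset.prod_univ_sum, Fintype.piFinset_univ]
  refine Finset.sum_congr rfl fun m _ => ?_
  rw [Finset.prod_mul_distrib]
  rw [prod_zpow_character_apply]
  exact congrArg _ (map_prod Circle.coeHom (fun i => l i x ^ (m i : ℤ)) Finset.univ).symm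

variable [MeasurableSpace G] [BorelSpace G] [IsTopologicalGroup G]
  (μ : Measure G) [μ.IsHaarMeasure] [IsProbabilityMeasure μ]

/-- One averaging per frequency suffices: the coefficients have total mass at most `2 ^ card ι`, and
each nonconstant one shrinks by `2 ^ (-card ι)`. The nonconstant terms thus contribute at most `1`,
and the constant term exactly `1`. -/
lemma setIntegral_riesz_le (Γ : Finset (PontryaginDual G)) (s t : ℝ)
    (ν : Measure G) [IsProbabilityMeasure ν]
    (hν : ∀ᵐ y ∂ν, y ∈ bohrSet (Γ : Set (PontryaginDual G)) t)
    (l : ι → PontryaginDual G)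
    (hl : ∀ m : ι → SignType, m ≠ 0 →
      ‖∫ y, (((∏ i, l i ^ (m i : ℤ) : PontryaginDual G) y : Circle) : ℂ) ∂ν‖ ≤ 1 / 2)
    (a : ι → ℂ) (ha : ∀ i, ‖a i‖ ≤ 1) :
    ∫ x in bohrSet (Γ : Set (PontryaginDual G)) s,
        ∏ i, (1 + (a i * ((l i x : Circle) : ℂ)).re) ∂μ ≤
      2 * μ.real (bohrSet (Γ : Set (PontryaginDual G)) (s + Fintype.card ι * t)) := by
  classical
  set c : (ι → SignType) → ℂ := fun m => ∏ i, rieszCoeff (a i) (m i) with hc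
  set χ : (ι → SignType) → PontryaginDual G := fun m => ∏ i, l i ^ (m i : ℤ) with hχ
  have hF : ∀ x, ∏ i, (1 + (a i * ((l i x : Circle) : ℂ)).re) = (trigPoly c χ x).re := fun x => by
    rw [hc, hχ, ← prod_one_add_re_eq_trigPoly, Complex.ofReal_re]
  have hF0 : ∀ x, 0 ≤ (trigPoly c χ x).re := fun x => by
    rw [← hF]
    refine Finset.prod_nonneg fun i _ => ?_
    have h := (abs_le.1 (Complex.abs_re_le_norm (a i * ((l i x : Circle) : ℂ)))).1
    rw [norm_mul, norm_coe_character, mul_one] at h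
    linarith [ha i]
  simp_rw [hF]
  refine (setIntegral_re_trigPoly_le_iterate μ Γ t ν hν χ (Fintype.card ι) s c hF0).trans ?_
  refine mul_le_mul_of_nonneg_right ?_ measureReal_nonneg
  have hsum : ∑ m, ‖c m‖ ≤ 2 ^ Fintype.card ι := by
    simp_rw [hc, norm_prod]
    rw [← Fintype.piFinset_univ,
      ← Finset.prod_univ_sum (fun _ => Finset.univ) (fun i m => ‖rieszCoeff (a i) m‖)]
    calc ∏ i, ∑ m : SignType, ‖rieszCoeff (a i) m‖ ≤ ∏ _i : ι, (2 : ℝ) :=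
          Finset.prod_le_prod (fun i _ => Finset.sum_nonneg fun _ _ => norm_nonneg _)
            fun i _ => sum_norm_rieszCoeff_le (ha i)
      _ = _ := by simp
  have hone : ‖c 0‖ * ‖∫ y, ((χ 0 y : Circle) : ℂ) ∂ν‖ ^ Fintype.card ι = 1 := by
    simp [hc, hχ, rieszCoeff]
  rw [← Finset.add_sum_erase _ _ (Finset.mem_univ (0 : ι → SignType)), hone]
  have hrest : ∑ m ∈ Finset.univ.erase (0 : ι → SignType),
      ‖c m‖ * ‖∫ y, ((χ m y : Circle) : ℂ) ∂ν‖ ^ Fintype.card ι ≤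
      (∑ m, ‖c m‖) * (1 / 2) ^ Fintype.card ι := by
    rw [Finset.sum_mul]
    refine (Finset.sum_le_sum fun m hm => ?_).trans
      (Finset.sum_le_sum_of_subset_of_nonneg (Finset.erase_subset _ _) fun _ _ _ => by positivity)
    gcongr
    exact hl m (Finset.ne_of_mem_erase hm)
  have : (∑ m, ‖c m‖) * (1 / 2) ^ Fintype.card ι ≤ 1 := by
    calc (∑ m, ‖c m‖) * (1 / 2) ^ Fintype.card ι ≤
        2 ^ Fintype.card ι * (1 / 2) ^ Fintype.card ι := by gcongr
      _ = 1 := by rw [← mul_pow]; norm_num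
  linarith

end Riesz

/-! ### Exponential moments and the entropy inequality -/

section Moment

/-- The right side is the chord of the convex function `exp` between `-s` and `s`. Since `|tanh s| <
1`, it is `cosh s` times an admissible Riesz factor. -/
lemma exp_mul_le_cosh_add {s y : ℝ} (hy : |y| ≤ 1) :
    Real.exp (s * y) ≤ Real.cosh s * (1 + Real.tanh s * y) := by
  rw [abs_le] at hy
  have h := convexOn_exp.2 (Set.mem_univ s) (Set.mem_univ (-s))
    (show 0 ≤ (1 + y) / 2 by linarith) (show 0 ≤ (1 - y) / 2 by linarith) (by ring)
  simp only [smul_eq_mul] at h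
  have e1 : (1 + y) / 2 * s + (1 - y) / 2 * -s = s * y := by ring
  rw [e1] at h
  refine h.trans (le_of_eq ?_)
  have hc := (Real.cosh_pos s).ne'
  have e2 : Real.cosh s * (1 + Real.tanh s * y) = Real.cosh s + Real.sinh s * y := by
    rw [Real.tanh_eq_sinh_div_cosh]; field_simp
  rw [e2, Real.cosh_eq, Real.sinh_eq]
  ring

variable {Ω ι : Type*} [Fintype ι] {w : ι → Ω → ℂ}

lemma norm_sum_mul_le {u : ι → ℂ} (hw1 : ∀ i x, ‖w i x‖ ≤ 1) (hu : ∀ i, ‖u i‖ ≤ 1) (x : Ω) :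
    ‖∑ i, u i * w i x‖ ≤ Fintype.card ι := by
  refine (norm_sum_le _ _).trans ?_
  calc ∑ i, ‖u i * w i x‖ ≤ ∑ _i : ι, (1 : ℝ) := Finset.sum_le_sum fun i _ => by
        rw [norm_mul]; exact mul_le_one₀ (hu i) (norm_nonneg _) (hw1 i x)
    _ = _ := by simp

variable [MeasurableSpace Ω] {β : Measure Ω} [IsProbabilityMeasure β]

lemma integrable_exp_of_bounded {h : Ω → ℝ} (hm : Measurable h) {C : ℝ} (hC : ∀ x, h x ≤ C) :
    Integrable (fun x => Real.exp (h x)) β :=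
  Integrable.of_bound (Real.measurable_exp.comp hm).aestronglyMeasurable (Real.exp C)
    (Filter.Eventually.of_forall fun x => by
      rw [Real.norm_eq_abs, abs_of_pos (Real.exp_pos _)]; exact Real.exp_le_exp.2 (hC x))

/-- A bound for Riesz products gives a subgaussian bound for the exponential moments. -/
lemma integral_exp_re_le (hw : ∀ i, Measurable (w i)) (hw1 : ∀ i x, ‖w i x‖ ≤ 1) {A : ℝ}
    (hA : ∀ a : ι → ℂ, (∀ i, ‖a i‖ ≤ 1) → ∫ x, ∏ i, (1 + (a i * w i x).re) ∂β ≤ A)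
    (s : ℝ) {u : ι → ℂ} (hu : ∀ i, ‖u i‖ ≤ 1) :
    ∫ x, Real.exp (s * (∑ i, u i * w i x).re) ∂β ≤
      A * Real.exp (Fintype.card ι * (s ^ 2 / 2)) := by
  have htanh : |Real.tanh s| ≤ 1 := (Real.abs_tanh_lt_one s).le
  set a : ι → ℂ := fun i => (Real.tanh s : ℂ) * u i with ha
  have ha1 : ∀ i, ‖a i‖ ≤ 1 := fun i => by
    rw [ha]; simp only [norm_mul, Complex.norm_real, Real.norm_eq_abs]
    exact mul_le_one₀ htanh (norm_nonneg _) (hu i)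
  have hre : ∀ i x, |(u i * w i x).re| ≤ 1 := fun i x => by
    refine (Complex.abs_re_le_norm _).trans ?_
    rw [norm_mul]; exact mul_le_one₀ (hu i) (norm_nonneg _) (hw1 i x)
  have hare : ∀ i x, (a i * w i x).re = Real.tanh s * (u i * w i x).re := fun i x => by
    rw [ha]; simp only [mul_assoc, Complex.re_ofReal_mul]
  have hare1 : ∀ i x, |(a i * w i x).re| ≤ 1 := fun i x => by
    refine (Complex.abs_re_le_norm _).trans ?_
    rw [norm_mul]; exact mul_le_one₀ (ha1 i) (norm_nonneg _) (hw1 i x)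
  have hprod0 : ∀ x, 0 ≤ ∏ i, (1 + (a i * w i x).re) := fun x =>
    Finset.prod_nonneg fun i _ => by linarith [(abs_le.1 (hare1 i x)).1]
  have hpt : ∀ x, Real.exp (s * (∑ i, u i * w i x).re) ≤
      Real.cosh s ^ Fintype.card ι * ∏ i, (1 + (a i * w i x).re) := fun x => by
    rw [Complex.re_sum, Finset.mul_sum, Real.exp_sum]
    calc ∏ i, Real.exp (s * (u i * w i x).re)
        ≤ ∏ i, (Real.cosh s * (1 + (a i * w i x).re)) :=
          Finset.prod_le_prod (fun i _ => (Real.exp_pos _).le) fun i _ => by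
            rw [hare]; exact exp_mul_le_cosh_add (hre i x)
      _ = _ := by rw [Finset.prod_mul_distrib]; simp
  have hmeas : Measurable fun x => ∏ i, (1 + (a i * w i x).re) :=
    Finset.measurable_prod _ fun i _ =>
      (Complex.measurable_re.comp ((hw i).const_mul (a i))).const_add 1
  have hint : Integrable (fun x => ∏ i, (1 + (a i * w i x).re)) β := by
    refine Integrable.of_bound hmeas.aestronglyMeasurable (∏ _i : ι, (2 : ℝ))
      (Filter.Eventually.of_forall fun x => ?_)
    rw [Real.norm_eq_abs, abs_of_nonneg (hprod0 x)]
    exact Finset.prod_le_prod (fun i _ => by linarith [(abs_le.1 (hare1 i x)).1])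
      fun i _ => by linarith [(abs_le.1 (hare1 i x)).2]
  have hA0 : 0 ≤ A := (integral_nonneg hprod0).trans (hA a ha1)
  calc ∫ x, Real.exp (s * (∑ i, u i * w i x).re) ∂β
      ≤ ∫ x, Real.cosh s ^ Fintype.card ι * ∏ i, (1 + (a i * w i x).re) ∂β :=
        integral_mono_of_nonneg (Filter.Eventually.of_forall fun x => (Real.exp_pos _).le)
          (hint.const_mul _) (Filter.Eventually.of_forall hpt)
    _ = Real.cosh s ^ Fintype.card ι * ∫ x, ∏ i, (1 + (a i * w i x).re) ∂β :=
        integral_const_mul _ _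
    _ ≤ Real.exp (s ^ 2 / 2) ^ Fintype.card ι * A := by
        have := (Real.cosh_pos s).le
        gcongr
        · exact integral_nonneg hprod0
        · exact Real.cosh_le_exp_half_sq s
        · exact hA a ha1
    _ = _ := by rw [← Real.exp_nat_mul, mul_comm]

/-- Bound the modulus by `|Re| + |Im|` and separate the two by the arithmetic-geometric mean
inequality, which doubles `t`. The imaginary part is the real part for the coefficients `-i u`, so
four real moments remain. -/
lemma integral_exp_norm_le (hw : ∀ i, Measurable (w i)) (hw1 : ∀ i x, ‖w i x‖ ≤ 1) {A : ℝ}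
    (hA : ∀ a : ι → ℂ, (∀ i, ‖a i‖ ≤ 1) → ∫ x, ∏ i, (1 + (a i * w i x).re) ∂β ≤ A)
    {t : ℝ} (ht : 0 ≤ t) {u : ι → ℂ} (hu : ∀ i, ‖u i‖ ≤ 1) :
    ∫ x, Real.exp (t * ‖∑ i, u i * w i x‖) ∂β ≤
      2 * A * Real.exp (Fintype.card ι * (2 * t ^ 2)) := by
  set g : Ω → ℂ := fun x => ∑ i, u i * w i x with hg
  have hgm : Measurable g := Finset.measurable_sum _ fun i _ => (hw i).const_mul (u i)
  have hgn : ∀ x, ‖g x‖ ≤ Fintype.card ι := norm_sum_mul_le hw1 hu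
  set v : ι → ℂ := fun i => -Complex.I * u i with hv
  have hv1 : ∀ i, ‖v i‖ ≤ 1 := fun i => by simpa [hv] using hu i
  have hvg : ∀ x, (∑ i, v i * w i x).re = (g x).im := fun x => by
    have : ∑ i, v i * w i x = -Complex.I * g x := by
      rw [hg, Finset.mul_sum]; exact Finset.sum_congr rfl fun i _ => by rw [hv]; ring
    rw [this]; simp
  have h1 := integral_exp_re_le hw hw1 hA (2 * t) hu
  have h2 := integral_exp_re_le hw hw1 hA (-(2 * t)) hu
  have h3 := integral_exp_re_le hw hw1 hA (2 * t) hv1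
  have h4 := integral_exp_re_le hw hw1 hA (-(2 * t)) hv1
  simp_rw [hvg] at h3 h4
  change ∫ x, Real.exp (2 * t * (g x).re) ∂β ≤ _ at h1
  change ∫ x, Real.exp (-(2 * t) * (g x).re) ∂β ≤ _ at h2
  have hIre : ∀ s : ℝ, Integrable (fun x => Real.exp (s * (g x).re)) β := fun s =>
    integrable_exp_of_bounded ((Complex.measurable_re.comp hgm).const_mul s)
      (C := |s| * Fintype.card ι) fun x => (le_abs_self _).trans (by
        rw [abs_mul]; gcongr; exact (Complex.abs_re_le_norm _).trans (hgn x))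
  have hIim : ∀ s : ℝ, Integrable (fun x => Real.exp (s * (g x).im)) β := fun s =>
    integrable_exp_of_bounded ((Complex.measurable_im.comp hgm).const_mul s)
      (C := |s| * Fintype.card ι) fun x => (le_abs_self _).trans (by
        rw [abs_mul]; gcongr; exact (Complex.abs_im_le_norm _).trans (hgn x))
  have habs : ∀ y : ℝ, Real.exp (2 * t * |y|) ≤
      Real.exp (2 * t * y) + Real.exp (-(2 * t) * y) := fun y => by
    rcases abs_choice y with h | h <;> rw [h]
    · linarith [Real.exp_pos (-(2 * t) * y)]
    · rw [mul_neg, ← neg_mul]; linarith [Real.exp_pos (2 * t * y)]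
  have hpt : ∀ x, Real.exp (t * ‖g x‖) ≤ 1 / 2 *
      ((Real.exp (2 * t * (g x).re) + Real.exp (-(2 * t) * (g x).re)) +
        (Real.exp (2 * t * (g x).im) + Real.exp (-(2 * t) * (g x).im))) := fun x => by
    have e1 : Real.exp (t * ‖g x‖) ≤ Real.exp (t * |(g x).re|) * Real.exp (t * |(g x).im|) := by
      rw [← Real.exp_add, ← mul_add]
      exact Real.exp_le_exp.2 (mul_le_mul_of_nonneg_left (Complex.norm_le_abs_re_add_abs_im _) ht)
    have e2 : ∀ y : ℝ, Real.exp (2 * t * y) = Real.exp (t * y) ^ 2 := fun y => by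
      rw [← Real.exp_nat_mul]; congr 1; push_cast; ring
    have h3 := habs (g x).re
    have h4 := habs (g x).im
    have h5 := two_mul_le_add_sq (Real.exp (t * |(g x).re|)) (Real.exp (t * |(g x).im|))
    rw [← e2, ← e2] at h5
    linarith
  have hJ1 := (hIre (2 * t)).add (hIre (-(2 * t)))
  have hJ2 := (hIim (2 * t)).add (hIim (-(2 * t)))
  calc ∫ x, Real.exp (t * ‖g x‖) ∂β
      ≤ ∫ x, 1 / 2 * ((Real.exp (2 * t * (g x).re) + Real.exp (-(2 * t) * (g x).re)) +
        (Real.exp (2 * t * (g x).im) + Real.exp (-(2 * t) * (g x).im))) ∂β :=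
        integral_mono_of_nonneg (Filter.Eventually.of_forall fun x => (Real.exp_pos _).le)
          ((hJ1.add hJ2).const_mul _) (Filter.Eventually.of_forall hpt)
    _ = 1 / 2 * ((∫ x, Real.exp (2 * t * (g x).re) ∂β + ∫ x, Real.exp (-(2 * t) * (g x).re) ∂β) +
        (∫ x, Real.exp (2 * t * (g x).im) ∂β + ∫ x, Real.exp (-(2 * t) * (g x).im) ∂β)) := by
        rw [integral_const_mul]; congr 1
        refine (integral_add hJ1 hJ2).trans ?_
        rw [integral_add' (hIre _) (hIre _),
          integral_add' (hIim _) (hIim _)]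
    _ ≤ 2 * A * Real.exp (Fintype.card ι * (2 * t ^ 2)) := by
        have e : (2 * t) ^ 2 / 2 = 2 * t ^ 2 := by ring
        rw [neg_sq] at h2 h4
        rw [e] at h1 h2 h3 h4
        linarith

/-- Young's inequality for the exponential function and its dual. -/
lemma mul_le_mul_log_add_exp {a M : ℝ} (ha : 0 ≤ a) (hM : 0 < M) (b : ℝ) :
    a * b ≤ a * Real.log M + a ^ 2 / M - 2 * a + Real.exp b := by
  rcases ha.eq_or_lt with rfl | ha
  · simp [(Real.exp_pos b).le]
  -- Young's inequality bounds `a * b` by `a log a - a + exp b`; the tangent to the logarithm at `M`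
  -- replaces `a log a` by a quantity an `L²` bound controls.
  have h1 : Real.log a - Real.log M ≤ a / M - 1 := by
    rw [← Real.log_div ha.ne' hM.ne']
    exact Real.log_le_sub_one_of_pos (by positivity)
  have h2 : b - Real.log a + 1 ≤ Real.exp b / a := by
    have := Real.add_one_le_exp (b - Real.log a)
    rwa [Real.exp_sub, Real.exp_log ha] at this
  rw [le_div_iff₀ ha] at h2
  have h3 := mul_le_mul_of_nonneg_left h1 ha.le
  have h4 : a * (a / M - 1) = a ^ 2 / M - a := by ring
  nlinarith

/-- The entropy bound for the pairing of an `L²` density with a function having a bounded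
exponential moment. -/
lemma integral_mul_le_log_add {p h : Ω → ℝ} (hp : ∀ x, 0 ≤ p x) (hpi : Integrable p β)
    (hp2 : Integrable (fun x => p x ^ 2) β) (hp1 : ∫ x, p x ∂β = 1) {M : ℝ} (hM : 0 < M)
    (hpM : ∫ x, p x ^ 2 ∂β = M) (hhm : Measurable h) {C : ℝ} (hC : ∀ x, |h x| ≤ C) {A : ℝ}
    (hA0 : 0 < A) (hA : ∫ x, Real.exp (h x) ∂β ≤ A) :
    ∫ x, p x * h x ∂β ≤ Real.log M + Real.log A := by
  have hph : Integrable (fun x => p x * h x) β := by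
    have := hpi.bdd_mul (f := h) (c := C) hhm.aestronglyMeasurable (Filter.Eventually.of_forall hC)
    simpa [mul_comm] using this
  have he : Integrable (fun x => Real.exp (h x)) β :=
    integrable_exp_of_bounded hhm fun x => (le_abs_self _).trans (hC x)
  -- Shifting `h` by `log A` makes the exponential term integrate to at most `1`; the quadratic term
  -- integrates to `1`, and the `-2` cancels both.
  have hpt : ∀ x, p x * h x ≤
      (p x * (Real.log M + Real.log A - 2) + p x ^ 2 / M) + Real.exp (h x) / A := fun x => by
    have := mul_le_mul_log_add_exp (hp x) hM (h x - Real.log A)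
    rw [Real.exp_sub, Real.exp_log hA0] at this
    linarith
  have i1 := hpi.mul_const (Real.log M + Real.log A - 2)
  have i2 := hp2.div_const M
  have i3 := he.div_const A
  have := integral_mono hph ((i1.add i2).add i3) hpt
  refine this.trans ?_
  rw [integral_add' (i1.add i2) i3, integral_add' i1 i2, integral_mul_const, integral_div,
    integral_div, hp1, hpM, div_self hM.ne']
  have : (∫ x, Real.exp (h x) ∂β) / A ≤ 1 := (div_le_one hA0).2 hA
  linarith

/-- The size bound for a family of functions whose Riesz products have bounded integrals and
which all correlate with `f`. -/
lemma card_mul_sq_le_log (hw : ∀ i, Measurable (w i)) (hw1 : ∀ i x, ‖w i x‖ ≤ 1)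
    (hA : ∀ a : ι → ℂ, (∀ i, ‖a i‖ ≤ 1) → ∫ x, ∏ i, (1 + (a i * w i x).re) ∂β ≤ 4)
    {f : Ω → ℂ} (hf : MemLp f 2 β) (hf0 : 0 < lpNorm f 1 β) {ε : ℝ} (hε : 0 < ε)
    (hcor : ∀ i, ε * lpNorm f 1 β ≤ ‖∫ x, f x * (starRingEnd ℂ) (w i x) ∂β‖) :
    Fintype.card ι * ε ^ 2 / 8 ≤
      Real.log (lpNorm f 2 β ^ 2 / lpNorm f 1 β ^ 2) + Real.log 8 := by
  set N := lpNorm f 1 β with hN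
  have hfi : Integrable f β := hf.integrable (by norm_num)
  have hf2 : Integrable (fun x => ‖f x‖ ^ 2) β := hf.integrable_norm_pow (by norm_num)
  have hN1 : N = ∫ x, ‖f x‖ ∂β := lpNorm_one_eq_integral_norm hf.1
  have hN2 : lpNorm f 2 β ^ 2 = ∫ x, ‖f x‖ ^ 2 ∂β := by
    have h := lpNorm_eq_integral_norm_rpow_toReal (p := 2) (f := f) (μ := β) (by norm_num)
      (by norm_num) hf.1
    have h0 : 0 ≤ ∫ x, ‖f x‖ ^ 2 ∂β := integral_nonneg fun x => by positivity
    simp only [ENNReal.toReal_ofNat, Real.rpow_ofNat] at h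
    rw [h, ← Real.rpow_natCast, ← Real.rpow_mul h0]
    norm_num
  set M := lpNorm f 2 β ^ 2 / N ^ 2 with hM
  have hM0 : 0 < M := by
    have h0 : lpNorm f 2 β ≠ 0 := by
      rw [Ne, lpNorm_eq_zero hf (by norm_num), ← lpNorm_eq_zero (hf.mono_exponent one_le_two)
        (by norm_num)]
      exact hf0.ne'
    positivity
  set z : ι → ℂ := fun i => ∫ x, f x * (starRingEnd ℂ) (w i x) ∂β with hz
  -- These phases align the correlations, so that pairing `f` with `∑ u i * w i` gives the sum of
  -- the `‖z i‖`.
  set u : ι → ℂ := fun i => z i / ‖z i‖ with hu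
  have hz0 : ∀ i, 0 < ‖z i‖ := fun i => lt_of_lt_of_le (by positivity) (hcor i)
  have hu1 : ∀ i, ‖u i‖ ≤ 1 := fun i => by
    simp [hu, (hz0 i).ne']
  have huz : ∀ i, (starRingEnd ℂ) (u i) * z i = (‖z i‖ : ℂ) := fun i => by
    have h0 : (‖z i‖ : ℂ) ≠ 0 := by exact_mod_cast (hz0 i).ne'
    simp only [hu, map_div₀, Complex.conj_ofReal]
    rw [div_mul_eq_mul_div, Complex.conj_mul', div_eq_iff h0, sq]
  set g : Ω → ℂ := fun x => ∑ i, u i * w i x with hg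
  have hgm : Measurable g := Finset.measurable_sum _ fun i _ => (hw i).const_mul (u i)
  have hgn : ∀ x, ‖g x‖ ≤ Fintype.card ι := norm_sum_mul_le hw1 hu1
  have hiw : ∀ i, Integrable (fun x => f x * (starRingEnd ℂ) (w i x)) β := fun i => by
    have := hfi.bdd_mul (f := fun x => (starRingEnd ℂ) (w i x)) (c := 1)
      (Complex.continuous_conj.measurable.comp (hw i)).aestronglyMeasurable
      (Filter.Eventually.of_forall fun x => by simpa using hw1 i x)
    simpa [mul_comm] using this
  have hsum : ∫ x, f x * (starRingEnd ℂ) (g x) ∂β = ((∑ i, ‖z i‖ : ℝ) : ℂ) := by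
    have e : ∀ x, f x * (starRingEnd ℂ) (g x) =
        ∑ i, (starRingEnd ℂ) (u i) * (f x * (starRingEnd ℂ) (w i x)) := fun x => by
      simp only [hg, map_sum, map_mul, Finset.mul_sum]
      exact Finset.sum_congr rfl fun i _ => by ring
    simp_rw [e]
    rw [integral_finsetSum _ fun i _ => (hiw i).const_mul _]
    simp_rw [integral_const_mul]
    push_cast
    exact Finset.sum_congr rfl fun i _ => huz i
  have hlow : Fintype.card ι * (ε * N) ≤ ∫ x, ‖f x‖ * ‖g x‖ ∂β := by
    have h1 : (Fintype.card ι : ℝ) * (ε * N) ≤ ∑ i, ‖z i‖ := by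
      rw [← nsmul_eq_mul, ← Finset.card_univ]
      exact Finset.card_nsmul_le_sum _ _ _ fun i _ => hcor i
    have h2 : ∑ i, ‖z i‖ ≤ ‖∫ x, f x * (starRingEnd ℂ) (g x) ∂β‖ := by
      rw [hsum, Complex.norm_real]; exact le_abs_self _
    refine h1.trans (h2.trans ((norm_integral_le_integral_norm _).trans (le_of_eq ?_)))
    simp
  -- This maximizes `t ε - 2 t ^ 2`, the gain per function minus its cost in the exponential moment,
  -- with value `ε ^ 2 / 8`.
  set t : ℝ := ε / 4 with ht
  set A : ℝ := 2 * 4 * Real.exp (Fintype.card ι * (2 * t ^ 2)) with hAdef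
  have hexp : ∫ x, Real.exp (t * ‖g x‖) ∂β ≤ A :=
    integral_exp_norm_le hw hw1 hA (by positivity) hu1
  have hent := integral_mul_le_log_add (β := β) (p := fun x => ‖f x‖ / N)
    (h := fun x => t * ‖g x‖) (M := M) (C := t * Fintype.card ι) (A := A)
    (fun x => by positivity) (hfi.norm.div_const N)
    (by simpa only [div_pow] using hf2.div_const (N ^ 2))
    (by rw [integral_div, ← hN1, div_self hf0.ne']) hM0
    (by simp_rw [div_pow]; rw [integral_div, ← hN2])
    (hgm.norm.const_mul t)
    (fun x => by rw [abs_of_nonneg (by positivity)]; gcongr; exact hgn x)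
    (by positivity) hexp
  have hlhs : ∫ x, ‖f x‖ / N * (t * ‖g x‖) ∂β = t / N * ∫ x, ‖f x‖ * ‖g x‖ ∂β := by
    rw [← integral_const_mul]
    exact integral_congr_ae (Filter.Eventually.of_forall fun x => by simp only; ring)
  have hlogA : Real.log A = Real.log 8 + Fintype.card ι * (2 * t ^ 2) := by
    rw [hAdef, Real.log_mul (by norm_num) (Real.exp_pos _).ne', Real.log_exp]; norm_num
  rw [hlhs, hlogA] at hent
  have h5 : t / N * (Fintype.card ι * (ε * N)) ≤ t / N * ∫ x, ‖f x‖ * ‖g x‖ ∂β := by gcongr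
  have h6 : t / N * (Fintype.card ι * (ε * N)) = Fintype.card ι * ε ^ 2 / 4 := by
    rw [ht]; field_simp
  have h7 : (Fintype.card ι : ℝ) * (2 * t ^ 2) = Fintype.card ι * ε ^ 2 / 8 := by
    rw [ht]; ring
  linarith

end Moment

/-! ### Dissociation modulo a set of characters -/

section Dissociated

variable {G : Type*} [CommGroup G] [TopologicalSpace G]

/-- `Λ` is dissociated modulo `S`: no nontrivial product of elements of `Λ` with exponents in
`{-1, 0, 1}` lies in `S`. -/
def IsDissociated (S : Set (PontryaginDual G)) (Λ : Finset (PontryaginDual G)) : Prop :=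
  ∀ m : PontryaginDual G → SignType, ∏ l ∈ Λ, l ^ (m l : ℤ) ∈ S → ∀ l ∈ Λ, m l = 0

lemma IsDissociated.subset {S : Set (PontryaginDual G)} {Λ Λ' : Finset (PontryaginDual G)}
    (h : IsDissociated S Λ) (hs : Λ' ⊆ Λ) : IsDissociated S Λ' := by
  classical
  intro m hm l hl
  have := h (fun l => if l ∈ Λ' then m l else 0) ?_ l (hs hl)
  · simpa [hl] using this
  · rw [← Finset.prod_subset hs (fun l _ hl => by simp [hl])]
    convert hm using 1
    exact Finset.prod_congr rfl fun l hl => by simp [hl]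

/-- If `γ` is not in `Λ`, adjoining it creates a nontrivial relation modulo `S`. The exponent of `γ`
there is `1` or `-1`, since otherwise `Λ` itself would carry the relation, so the relation can be
solved for `γ`. -/
lemma IsDissociated.exists_eq_prod_mul {S : Set (PontryaginDual G)} (h1 : 1 ∈ S)
    (hinv : ∀ γ ∈ S, γ⁻¹ ∈ S) {Λ : Finset (PontryaginDual G)} (hΛ : IsDissociated S Λ)
    {γ : PontryaginDual G}
    (hγ : ∀ Λ' : Finset (PontryaginDual G), Λ ⊆ Λ' → γ ∈ Λ' → Λ'.card ≤ Λ.card + 1 →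
      IsDissociated S Λ' → γ ∈ Λ) :
    ∃ m : PontryaginDual G → SignType, ∃ s ∈ S, γ = (∏ l ∈ Λ, l ^ (m l : ℤ)) * s := by
  classical
  by_cases hmem : γ ∈ Λ
  · refine ⟨fun l => if l = γ then 1 else 0, 1, h1, ?_⟩
    rw [Finset.prod_eq_single_of_mem γ hmem fun l _ hl => by simp [hl]]
    simp
  have hnd : ¬ IsDissociated S (insert γ Λ) := fun h =>
    hmem (hγ _ (Finset.subset_insert _ _) (Finset.mem_insert_self _ _)
      (Finset.card_insert_le _ _) h)
  unfold IsDissociated at hnd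
  push Not at hnd
  obtain ⟨m, hm, l₀, hl₀, hne⟩ := hnd
  rw [Finset.prod_insert hmem] at hm
  rcases hc : m γ with _ | _ | _
  · rw [hc] at hm
    have h0 := hΛ m (by simpa using hm)
    rcases Finset.mem_insert.1 hl₀ with rfl | h
    · exact absurd hc hne
    · exact absurd (h0 _ h) hne
  · rw [hc] at hm
    refine ⟨m, _, hinv _ hm, ?_⟩
    simp
  · rw [hc] at hm
    refine ⟨fun l => - m l, _, hm, ?_⟩
    simp

/-- Take a dissociated subset of `T` of maximal cardinality; the empty set is a candidate and `K`
bounds the sizes. -/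
lemma exists_isDissociated_span {S T : Set (PontryaginDual G)} (h1 : 1 ∈ S)
    (hinv : ∀ γ ∈ S, γ⁻¹ ∈ S) {K : ℕ}
    (hK : ∀ Λ : Finset (PontryaginDual G), ↑Λ ⊆ T → IsDissociated S Λ → Λ.card < K) :
    ∃ Λ : Finset (PontryaginDual G), Λ.card < K ∧ ∀ γ ∈ T,
      ∃ m : PontryaginDual G → SignType, ∃ s ∈ S, γ = (∏ l ∈ Λ, l ^ (m l : ℤ)) * s := by
  classical
  set C : Set ℕ := {n | ∃ Λ : Finset (PontryaginDual G), ↑Λ ⊆ T ∧ IsDissociated S Λ ∧ Λ.card = n}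
    with hC
  have hne : C.Nonempty := ⟨0, ∅, by simp, fun _ _ l hl => absurd hl (Finset.notMem_empty l), rfl⟩
  have hbd : BddAbove C := ⟨K, by rintro n ⟨Λ, h, h', rfl⟩; exact (hK Λ h h').le⟩
  obtain ⟨Λ, hT, hd, hcard⟩ := Nat.sSup_mem hne hbd
  refine ⟨Λ, hK Λ hT hd, fun γ hγ => hd.exists_eq_prod_mul h1 hinv ?_⟩
  intro Λ' hsub hmem _ hd'
  by_contra hnot
  have hd2 : IsDissociated S (insert γ Λ) := hd'.subset (Finset.insert_subset hmem hsub)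
  have := le_csSup hbd (show (insert γ Λ).card ∈ C from
    ⟨_, by simpa [Set.insert_subset_iff] using ⟨hγ, hT⟩, hd2, rfl⟩)
  rw [Finset.card_insert_of_notMem hnot, ← hcard] at this
  omega

lemma circleVal_zpow_sign_le (z : Circle) (m : SignType) :
    circleVal (z ^ (m : ℤ)) ≤ circleVal z := by
  rcases m with _ | _ | _
  · simpa [circleVal_one] using circleVal_nonneg z
  · simp [circleVal_inv]
  · simp

lemma circleVal_prod_zpow_le (Λ : Finset (PontryaginDual G)) (m : PontryaginDual G → SignType)
    (x : G) : circleVal ((∏ l ∈ Λ, l ^ (m l : ℤ) : PontryaginDual G) x) ≤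
      ∑ l ∈ Λ, circleVal (l x) := by
  classical
  rw [prod_zpow_character_apply]
  induction Λ using Finset.induction_on with
  | empty => simp [circleVal_one]
  | insert l Λ hl ih =>
    rw [Finset.prod_insert hl, Finset.sum_insert hl]
    exact (circleVal_mul_le _ _).trans (add_le_add (circleVal_zpow_sign_le (l x) (m l)) ih)

lemma norm_one_sub_mul_le (z w : Circle) :
    ‖(1 : ℂ) - ((z * w : Circle) : ℂ)‖ ≤ ‖(1 : ℂ) - z‖ + ‖(1 : ℂ) - w‖ := by
  have : (1 : ℂ) - ((z * w : Circle) : ℂ) = (1 - z) + z * (1 - w) := by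
    rw [Circle.coe_mul]; ring
  rw [this]
  refine (norm_add_le _ _).trans ?_
  rw [norm_mul, Circle.norm_coe, one_mul]

variable [MeasurableSpace G]

/-- The characters whose integral against `ν` has modulus at least `1 / 2`. -/
def largeSpectrum (ν : Measure G) : Set (PontryaginDual G) :=
  {γ | 1 / 2 ≤ ‖∫ y, ((γ y : Circle) : ℂ) ∂ν‖}

lemma one_mem_largeSpectrum (ν : Measure G) [IsProbabilityMeasure ν] :
    1 ∈ largeSpectrum ν := by
  simp [largeSpectrum]
  norm_num

lemma inv_mem_largeSpectrum {ν : Measure G} {γ : PontryaginDual G} (h : γ ∈ largeSpectrum ν) :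
    γ⁻¹ ∈ largeSpectrum ν := by
  have : ∫ y, ((γ⁻¹ y : Circle) : ℂ) ∂ν = (starRingEnd ℂ) (∫ y, ((γ y : Circle) : ℂ) ∂ν) := by
    rw [← integral_conj]
    exact integral_congr_ae (Filter.Eventually.of_forall fun y => Circle.coe_inv_eq_conj (γ y))
  simp only [largeSpectrum, Set.mem_ofPred_eq] at h ⊢
  rw [this, RCLike.norm_conj]
  exact h

variable (μ : Measure G)

lemma integral_bohrMeasure (Γ : Finset (PontryaginDual G)) (s : ℝ) (h : G → ℝ) :
    ∫ x, h x ∂(bohrMeasure μ Γ s) =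
      (μ.real (bohrSet (Γ : Set (PontryaginDual G)) s))⁻¹ *
        ∫ x in bohrSet (Γ : Set (PontryaginDual G)) s, h x ∂μ := by
  rw [bohrMeasure, ProbabilityTheory.cond, integral_smul_measure, smul_eq_mul,
    ENNReal.toReal_inv, Measure.real]

variable [μ.IsHaarMeasure] [IsProbabilityMeasure μ]

lemma isProbabilityMeasure_bohrMeasure (Γ : Finset (PontryaginDual G)) {s : ℝ} (hs : 0 < s) :
    IsProbabilityMeasure (bohrMeasure μ Γ s) := by
  refine ProbabilityTheory.cond_isProbabilityMeasure fun h => ?_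
  have := measureReal_bohrSet_pos μ Γ hs
  rw [Measure.real, h] at this
  simp at this

variable [BorelSpace G] [IsTopologicalGroup G]

/-- A dissociated subset of the large spectrum of `f` is small. -/
lemma IsDissociated.card_lt (Γ : Finset (PontryaginDual G)) {δ t : ℝ} (hδ : 0 < δ) {K : ℕ}
    (hreg : μ.real (bohrSet (Γ : Set (PontryaginDual G)) (δ + K * t)) ≤
      2 * μ.real (bohrSet (Γ : Set (PontryaginDual G)) δ))
    (ν : Measure G) [IsProbabilityMeasure ν]
    (hν : ∀ᵐ y ∂ν, y ∈ bohrSet (Γ : Set (PontryaginDual G)) t)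
    {f : G → ℂ} (hf : MemLp f 2 (bohrMeasure μ Γ δ)) (hf0 : 0 < lpNorm f 1 (bohrMeasure μ Γ δ))
    {ε : ℝ} (hε : 0 < ε)
    (hK : Real.log (lpNorm f 2 (bohrMeasure μ Γ δ) ^ 2 / lpNorm f 1 (bohrMeasure μ Γ δ) ^ 2) +
      Real.log 8 < K * ε ^ 2 / 8) {Λ : Finset (PontryaginDual G)}
    (hΛT : ∀ γ ∈ Λ, ε * lpNorm f 1 (bohrMeasure μ Γ δ) ≤ ‖fourierCoeff (bohrMeasure μ Γ δ) f γ‖)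
    (hΛ : IsDissociated (largeSpectrum ν) Λ) : Λ.card < K := by
  classical
  have := isProbabilityMeasure_bohrMeasure μ Γ hδ
  by_contra! hcard
  -- Passing to exactly `K` characters makes the Riesz bound enlarge the radius by exactly `K * t`,
  -- as in `hreg`.
  obtain ⟨Λ', hsub, hcard'⟩ := Finset.exists_subset_card_eq hcard
  have hd := hΛ.subset hsub
  have hc : Fintype.card Λ' = K := by simp [hcard']
  have hpos := measureReal_bohrSet_pos μ Γ hδ
  have hriesz : ∀ a : Λ' → ℂ, (∀ i, ‖a i‖ ≤ 1) →
      ∫ x, ∏ i : Λ', (1 + (a i * (((i : PontryaginDual G) x : Circle) : ℂ)).re)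
        ∂(bohrMeasure μ Γ δ) ≤ 4 := by
    intro a ha
    rw [integral_bohrMeasure, inv_mul_le_iff₀ hpos]
    refine (setIntegral_riesz_le μ Γ δ t ν hν (fun i : Λ' => (i : PontryaginDual G)) ?_ a ha).trans
      ?_
    · intro m hm
      -- A nonzero sign pattern with large transform would be a relation modulo `largeSpectrum ν`;
      -- extended by zero it contradicts dissociation.
      by_contra! hlarge
      refine hm (funext fun i => ?_)
      have := hd (fun l => if h : l ∈ Λ' then m ⟨l, h⟩ else 0) ?_ i i.2
      · simpa using this
      · rw [← Finset.prod_coe_sort]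
        simpa [largeSpectrum] using hlarge.le
    · rw [hc]; linarith
  have := card_mul_sq_le_log (β := bohrMeasure μ Γ δ)
    (w := fun (i : Λ') x => (((i : PontryaginDual G) x : Circle) : ℂ))
    (fun i => measurable_coe_character _) (fun i x => (norm_coe_character _ x).le) hriesz hf hf0 hε
    (fun i => hΛT _ (hsub i.2))
  rw [hc] at this
  linarith

end Dissociated

lemma lpNorm_one_le_lpNorm_two {Ω : Type*} [MeasurableSpace Ω] {β : Measure Ω}
    [IsProbabilityMeasure β] {f : Ω → ℂ} (hf : MemLp f 2 β) : lpNorm f 1 β ≤ lpNorm f 2 β := by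
  rw [← toReal_eLpNorm hf.1, ← toReal_eLpNorm hf.1]
  exact ENNReal.toReal_mono hf.2.ne (eLpNorm_le_eLpNorm_of_exponent_le one_le_two hf.1)

end LocalChang

/-! ### The local Chang theorem -/

theorem mainTheorem4 (cR CR : ℝ) (hcR : 0 < cR) (hCR : 0 < CR) :
    ∃ C c : ℝ, 0 < C ∧ 0 < c ∧
      ∀ (G : Type*) [CommGroup G] [TopologicalSpace G] [IsTopologicalGroup G]
        [CompactSpace G] [T2Space G] [MeasurableSpace G] [BorelSpace G]
        (μ : Measure G) [μ.IsHaarMeasure] [μ.Regular] [IsProbabilityMeasure μ]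
        (Γ : Finset (PontryaginDual G)) (δ : ℝ) (_ : 0 < δ) (_ : δ ≤ 1)
        (_ : LocalChang.IsRegularBohr cR CR μ Γ δ)
        (β : Measure G) (_ : β = LocalChang.bohrMeasure μ Γ δ)
        (f : G → ℂ) (_ : MemLp f 2 β) (_ : ¬ f =ᵐ[β] 0)
        (ε η : ℝ) (_ : 0 < ε) (_ : ε ≤ 1) (_ : 0 < η) (_ : η ≤ 1),
        ∃ (Λ : Finset (PontryaginDual G)) (δ' : ℝ), 0 < δ' ∧ δ' ≤ 1 ∧
          (Λ.card : ℝ) ≤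
            C * (ε ^ 2)⁻¹ * (1 + Real.log (lpNorm f 2 β ^ 2 / lpNorm f 1 β ^ 2)) ∧
          c * (δ * η * ε ^ 2 /
              ((max 1 (Γ.card : ℝ)) ^ 2 *
                (1 + Real.log (lpNorm f 2 β ^ 2 / lpNorm f 1 β ^ 2)))) ≤ δ' ∧
          {γ : PontryaginDual G |
              ε * lpNorm f 1 β ≤ ‖LocalChang.fourierCoeff β f γ‖} ⊆
            {γ : PontryaginDual G |
              ∀ x ∈ LocalChang.bohrSet
                  ((Γ : Set (PontryaginDual G)) ∪ (Λ : Set (PontryaginDual G))) δ',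
                ‖(1 : ℂ) - ((γ x : Circle) : ℂ)‖ ≤ η} := by

  -- With `κ = c₁ / max 1 d`, regularity applies and its error is at most `1`, so the measure at
  -- most doubles.
  set c₁ : ℝ := min 1 (min cR (1 / CR)) with hc₁
  have hc₁0 : 0 < c₁ := by positivity
  have hc₁1 : c₁ ≤ 1 := min_le_left _ _
  have hc₁R : c₁ ≤ cR := (min_le_right _ _).trans (min_le_left _ _)
  have hc₁C : CR * c₁ ≤ 1 := by
    have : c₁ ≤ 1 / CR := (min_le_right _ _).trans (min_le_right _ _)
    rwa [le_div_iff₀ hCR, mul_comm] at this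
  -- Here `4428 = 108 * 41`, combining the loss in the almost invariant radius with the bound on
  -- `K`.
  refine ⟨41, c₁ / 4428, by norm_num, by positivity, ?_⟩
  intro G _ _ _ _ _ _ _ μ _ _ _ Γ δ hδ hδ1 hreg β hβ f hf hf0 ε η hε hε1 hη hη1
  subst hβ
  have := LocalChang.isProbabilityMeasure_bohrMeasure μ Γ hδ
  set β := LocalChang.bohrMeasure μ Γ δ with hβ
  set B : ℝ → Set G := LocalChang.bohrSet (Γ : Set (PontryaginDual G)) with hB
  set D : ℝ := max 1 (Γ.card : ℝ) with hD
  have hD1 : 1 ≤ D := le_max_left _ _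
  have hDc : (Γ.card : ℝ) ≤ D := le_max_right _ _
  have hN0 : 0 < lpNorm f 1 β := by
    refine lt_of_le_of_ne lpNorm_nonneg fun h => hf0 ?_
    exact (lpNorm_eq_zero (hf.mono_exponent one_le_two) one_ne_zero).1 h.symm
  set ℓ : ℝ := Real.log (lpNorm f 2 β ^ 2 / lpNorm f 1 β ^ 2) with hℓ
  have hℓ0 : 0 ≤ ℓ := by
    refine Real.log_nonneg ((one_le_div (by positivity)).2 ?_)
    gcongr
    exact LocalChang.lpNorm_one_le_lpNorm_two hf
  -- The factor `40` gives `K ε ^ 2 / 8 ≥ 5 (1 + ℓ)`, which exceeds `ℓ + log 8` because `log 8 < 3`;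
  -- the ceiling is absorbed in `41`.
  set K : ℕ := ⌈40 * (ε ^ 2)⁻¹ * (1 + ℓ)⌉₊ with hK
  have hε2 : 1 ≤ (ε ^ 2)⁻¹ := (one_le_inv₀ (by positivity)).2 (pow_le_one₀ hε.le hε1)
  have hKlow : 40 * (ε ^ 2)⁻¹ * (1 + ℓ) ≤ K := Nat.le_ceil _
  have hKup : (K : ℝ) ≤ 41 * (ε ^ 2)⁻¹ * (1 + ℓ) := by
    have h := (Nat.ceil_lt_add_one (show 0 ≤ 40 * (ε ^ 2)⁻¹ * (1 + ℓ) by positivity)).le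
    have : 1 ≤ (ε ^ 2)⁻¹ * (1 + ℓ) := one_le_mul_of_one_le_of_one_le hε2 (by linarith)
    linarith
  have hK0 : (0 : ℝ) < K := lt_of_lt_of_le (by positivity) hKlow
  have hKlog : ℓ + Real.log 8 < K * ε ^ 2 / 8 := by
    have h8 : Real.log 8 < 3 := by
      have : Real.log 8 = 3 * Real.log 2 := by
        rw [show (8 : ℝ) = 2 ^ 3 by norm_num, Real.log_pow]; norm_num
      linarith [Real.log_two_lt_d9]
    have h1 : 40 * (1 + ℓ) ≤ K * ε ^ 2 := by
      have h2 := mul_le_mul_of_nonneg_right hKlow (sq_nonneg ε)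
      have h3 : 40 * (ε ^ 2)⁻¹ * (1 + ℓ) * ε ^ 2 = 40 * (1 + ℓ) := by field_simp
      linarith
    linarith
  -- Chosen so that `δ + K t = (1 + c₁ / D) δ`.
  set t : ℝ := δ * c₁ / (K * D) with ht
  have ht0 : 0 < t := by positivity
  have hregt : μ.real (B (δ + K * t)) ≤ 2 * μ.real (B δ) := by
    have hpos := LocalChang.measureReal_bohrSet_pos μ Γ hδ
    have hκd : |c₁ / D| * (Γ.card : ℝ) ≤ c₁ := by
      rw [abs_of_pos (by positivity), div_mul_eq_mul_div, div_le_iff₀ (by positivity)]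
      gcongr
    have h := hreg (c₁ / D) (hκd.trans hc₁R)
    have e : (1 + c₁ / D) * δ = δ + K * t := by rw [ht]; field_simp
    rw [e] at h
    have h2 : CR * (|c₁ / D| * (Γ.card : ℝ)) ≤ 1 :=
      (mul_le_mul_of_nonneg_left hκd hCR.le).trans hc₁C
    have h3 := (le_abs_self _).trans (h.trans h2)
    rw [← div_le_iff₀ hpos]
    linarith
  obtain ⟨r, κ, hκr, hrt, hκ0, hκ, hinv⟩ :=
    LocalChang.exists_almost_invariant_radius μ Γ ht0 hη hη1
  have hνp := LocalChang.isProbabilityMeasure_bohrMeasure μ Γ (hκ0.trans hκr)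
  set ν := LocalChang.bohrMeasure μ Γ r with hν
  have hνt : ∀ᵐ y ∂ν, y ∈ B t := by
    filter_upwards [ProbabilityTheory.ae_cond_mem (LocalChang.measurableSet_bohrSet Γ r)] with y hy
    exact LocalChang.bohrSet_mono _ hrt hy
  obtain ⟨Λ, hΛK, hΛ⟩ := LocalChang.exists_isDissociated_span
    (T := {γ | ε * lpNorm f 1 β ≤ ‖LocalChang.fourierCoeff β f γ‖})
    (LocalChang.one_mem_largeSpectrum ν) (fun γ => LocalChang.inv_mem_largeSpectrum)
    (fun Λ hT hd => LocalChang.IsDissociated.card_lt μ Γ hδ hregt ν hνt hf hN0 hε hKlog hT hd)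
  have hΛK' : (Λ.card : ℝ) ≤ K := by exact_mod_cast hΛK.le
  -- This is `t η / (108 D)`, the guaranteed lower bound for `κ`.
  set δ' : ℝ := δ * η * c₁ / (108 * K * D ^ 2) with hδ'
  have hδ'0 : 0 < δ' := by positivity
  have hδ'κ : δ' ≤ κ := by
    refine le_trans (le_of_eq ?_) hκ
    change _ = t * η / (108 * D)
    rw [hδ', ht]; field_simp
  have hKδ' : K * δ' ≤ η / 108 := by
    have e : K * δ' = δ * c₁ / D ^ 2 * (η / 108) := by rw [hδ']; field_simp
    rw [e]
    refine mul_le_of_le_one_left (by positivity) ?_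
    rw [div_le_one (by positivity)]
    exact (mul_le_one₀ hδ1 hc₁0.le hc₁1).trans (one_le_pow₀ hD1)
  refine ⟨Λ, δ', hδ'0, ?_, hΛK'.trans hKup, ?_, ?_⟩
  · have hK1 : (1 : ℝ) ≤ K := by
      have : 0 < K := by exact_mod_cast hK0
      exact_mod_cast this
    nlinarith
  · have hL : 0 < 1 + ℓ := by linarith
    have hKe : K * ε ^ 2 ≤ 41 * (1 + ℓ) := by
      have h2 := mul_le_mul_of_nonneg_right hKup (sq_nonneg ε)
      have h3 : 41 * (ε ^ 2)⁻¹ * (1 + ℓ) * ε ^ 2 = 41 * (1 + ℓ) := by field_simp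
      linarith
    have e : c₁ / 4428 * (δ * η * ε ^ 2 / (D ^ 2 * (1 + ℓ))) =
        δ' * (K * ε ^ 2 / (41 * (1 + ℓ))) := by
      rw [hδ']; field_simp; norm_num
    rw [e]
    exact mul_le_of_le_one_right hδ'0.le ((div_le_one (by positivity)).2 hKe)
  · intro γ hγ x hx
    -- The product over `Λ` deviates from `1` by at most `2π K δ' ≤ 8 η / 108`, and the factor `s`
    -- by at most `η / 2`.
    obtain ⟨m, s, hs, rfl⟩ := hΛ γ hγ
    have h1 := LocalChang.circleVal_prod_zpow_le Λ m x
    have h2 : ∑ l ∈ Λ, LocalChang.circleVal (l x) ≤ K * δ' := by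
      calc ∑ l ∈ Λ, LocalChang.circleVal (l x) ≤ Λ.card • δ' :=
            Finset.sum_le_card_nsmul _ _ _ fun l hl => hx l (Or.inr hl)
        _ ≤ K * δ' := by rw [nsmul_eq_mul]; gcongr
    have h3 : x ∈ B κ := fun l hl => (hx l (Or.inl hl)).trans hδ'κ
    have h4 := LocalChang.norm_one_sub_le_of_almost_invariant μ Γ hκ0 hκr hη hinv s hs h3
    have h5 := LocalChang.norm_one_sub_le_circleVal ((∏ l ∈ Λ, l ^ (m l : ℤ) : PontryaginDual G) x)
    have h6 : 2 * Real.pi * LocalChang.circleVal ((∏ l ∈ Λ, l ^ (m l : ℤ) : PontryaginDual G) x) ≤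
        2 * 4 * (η / 108) := by
      have := LocalChang.circleVal_nonneg ((∏ l ∈ Λ, l ^ (m l : ℤ) : PontryaginDual G) x)
      gcongr
      · exact Real.pi_le_four
      · linarith
    rw [LocalChang.mul_character_apply]
    refine (LocalChang.norm_one_sub_mul_le _ _).trans ?_
    linarith
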